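/- Let $L$ be a bounded distributive lattice. A function $f\colon L^k\to L$ (with $k\in\mathbb{N}$) is called compatible if for every lattice congruence $\theta$ on $L$ and all $(a_1,b_1),\dots,(a_k,b_k)\in\theta$ one has $(f(a_1,\dots,a_k),f(b_1,\dots,b_k))\in\theta$. It is called a polynomial function if it is built from the projections and the constants in $L$ by finitely many applications of $\wedge$ and $\vee$. The lattice $L$ is called affine complete if every compatible function on $L$, of any finite arity, is a polynomial function. The class of affine complete bounded distributive lattices is closed under free products of nonempty families. That is, let $I$ be a nonempty set (finite or infinite) and let $(L_i)_{i\in I}$ be a family of affine complete bounded distributive lattices. Then the free product of $(L_i)_{i\in I}$, i.e. its coproduct in the category of bounded distributive lattices with $(0,1)$-preserving lattice homomorphisms, exists and is affine complete. -/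

import Mathlib

open CategoryTheory CategoryTheory.Limits

universe v u

/-- A `k`-ary function on a lattice is compatible if it preserves every lattice congruence. -/
def IsCompatible {L : Type*} [Lattice L] {k : ℕ} (f : (Fin k → L) → L) : Prop :=
  ∀ (θ : LatticeCon L) (a b : Fin k → L), (∀ i, θ.r (a i) (b i)) → θ.r (f a) (f b)

/-- The `k`-ary polynomial functions on a lattice `L`: those built from the projections and the
constants in `L` by finitely many applications of meet and join. -/
inductive IsPolynomialFun {L : Type*} [Lattice L] {k : ℕ} : ((Fin k → L) → L) → Prop
  | const (c : L) : IsPolynomialFun (fun _ => c)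
  | proj (i : Fin k) : IsPolynomialFun (fun x => x i)
  | inf {f g : (Fin k → L) → L} :
      IsPolynomialFun f → IsPolynomialFun g → IsPolynomialFun (fun x => f x ⊓ g x)
  | sup {f g : (Fin k → L) → L} :
      IsPolynomialFun f → IsPolynomialFun g → IsPolynomialFun (fun x => f x ⊔ g x)

/-- A bounded distributive lattice is affine complete if every compatible function on it, of any
finite arity, is a polynomial function. -/
def IsAffineComplete (L : Type*) [DistribLattice L] [BoundedOrder L] : Prop :=
  ∀ (k : ℕ) (f : (Fin k → L) → L), IsCompatible f → IsPolynomialFun f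

/-! Homomorphisms to `Prop` (prime filters) separate points, so inequalities are checked pointwise.
By `isAffineComplete_iff`, affine completeness means that no proper interval is Boolean. Suppose
`IsRelComplemented a b` in the coproduct with `b ≰ a`; take a prime `p` containing `b` but not `a`,
and any index `i`. `exists_retraction` retracts the coproduct onto `L i`, sending the other summands
to `⊥` or `⊤` according to `p`. As the summands generate, the interval can be shrunk so that its
image under the retraction has bounds `t`, `s` in `L i` still separated by `p`. That image is again
Boolean, contradicting affine completeness of `L i`. Existence: the free product is realised as sets
of points of the product of the prime spectra. -/

/-! ### Prime separation by homomorphisms to `Prop` -/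

section Prime

variable {L : Type*} [DistribLattice L] [BoundedOrder L]

open Order in
/-- Homomorphisms to the two-element lattice separate the elements of a bounded distributive
lattice. -/
theorem exists_boundedLatticeHom_prop_of_not_le {a b : L} (h : ¬ b ≤ a) :
    ∃ p : BoundedLatticeHom L Prop, p b ∧ ¬ p a := by
  have hd : Disjoint (PFilter.principal b : Set L) (Ideal.principal a : Set L) := by
    rw [Set.disjoint_left]
    intro x hx hx'
    exact h ((PFilter.mem_principal.1 hx).trans (Ideal.mem_principal.1 hx'))
  obtain ⟨J, hJ, haJ, hbJ⟩ := DistribLattice.prime_ideal_of_disjoint_filter_ideal hd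
  refine ⟨⟨⟨⟨fun x => x ∉ J, fun x y => ?_⟩, fun x y => ?_⟩, ?_, ?_⟩, ?_, ?_⟩
  · refine propext ?_
    change x ⊔ y ∉ J ↔ (x ∉ J ∨ y ∉ J)
    rw [Ideal.sup_mem_iff]
    tauto
  · refine propext ?_
    change x ⊓ y ∉ J ↔ (x ∉ J ∧ y ∉ J)
    refine ⟨fun hxy => ⟨fun hx => hxy (J.lower inf_le_left hx),
      fun hy => hxy (J.lower inf_le_right hy)⟩, fun hxy hm => ?_⟩
    exact (hJ.mem_or_mem hm).elim hxy.1 hxy.2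
  · exact propext ⟨fun _ => trivial, fun _ => hJ.toIsProper.top_notMem⟩
  · exact propext ⟨fun hb => hb J.bot_mem, fun hf => hf.elim⟩
  · exact Set.disjoint_left.1 hbJ (PFilter.mem_principal.2 le_rfl)
  · exact fun ha => ha (haJ (Ideal.mem_principal_self : a ∈ Ideal.principal a))

theorem le_of_forall_boundedLatticeHom_prop {a b : L}
    (h : ∀ p : BoundedLatticeHom L Prop, p b → p a) : b ≤ a := by
  by_contra hba
  obtain ⟨p, hb, ha⟩ := exists_boundedLatticeHom_prop_of_not_le hba
  exact ha (h p hb)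

theorem BoundedLatticeHom.prop_inf (p : BoundedLatticeHom L Prop) (x y : L) :
    p (x ⊓ y) ↔ p x ∧ p y := iff_of_eq (map_inf p x y)

theorem BoundedLatticeHom.prop_sup (p : BoundedLatticeHom L Prop) (x y : L) :
    p (x ⊔ y) ↔ p x ∨ p y := iff_of_eq (map_sup p x y)

theorem BoundedLatticeHom.prop_top (p : BoundedLatticeHom L Prop) : p ⊤ :=
  (iff_of_eq (map_top p)).2 trivial

theorem BoundedLatticeHom.not_prop_bot (p : BoundedLatticeHom L Prop) : ¬ p ⊥ :=
  fun h => (iff_of_eq (map_bot p)).1 h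

theorem BoundedLatticeHom.prop_mono (p : BoundedLatticeHom L Prop) {x y : L} (h : x ≤ y) :
    p x → p y := OrderHomClass.mono p h

/-- A compatible function respects membership in every prime filter. -/
theorem IsCompatible.prop_iff {k : ℕ} {f : (Fin k → L) → L} (hf : IsCompatible f)
    (p : BoundedLatticeHom L Prop) {x y : Fin k → L} (h : ∀ i, p (x i) ↔ p (y i)) :
    p (f x) ↔ p (f y) :=
  iff_of_eq (hf (LatticeCon.ker p) x y fun i => propext (h i))

end Prime

/-! ### Grätzer's characterization of affine completeness -/

section AffineComplete

variable {L : Type*} [DistribLattice L]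

/-- Every element has a complement relative to the interval from `a ⊓ b` to `b`. -/
def IsRelComplemented (a b : L) : Prop :=
  ∀ x, ∃ z, b ⊓ x ⊓ z ≤ a ∧ b ≤ a ⊔ x ⊔ z

theorem IsRelComplemented.mono {a a' b b' : L} (h : IsRelComplemented a b) (ha : a ≤ a')
    (hb : b' ≤ b) : IsRelComplemented a' b' := by
  intro x
  obtain ⟨z, h₁, h₂⟩ := h x
  exact ⟨z, le_trans (by gcongr) (h₁.trans ha), (hb.trans h₂).trans (by gcongr)⟩

theorem IsPolynomialFun.monotone {k : ℕ} {f : (Fin k → L) → L} (hf : IsPolynomialFun f) :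
    Monotone f := by
  induction hf with
  | const c => exact monotone_const
  | proj i => exact fun x y h => h i
  | inf _ _ hf hg => exact hf.inf hg
  | sup _ _ hf hg => exact hf.sup hg

variable [BoundedOrder L]

/-- Relative complementation is compatible but order-reversing, whereas polynomial functions are
monotone. -/
theorem IsAffineComplete.le_of_isRelComplemented (hL : IsAffineComplete L) {a b : L}
    (h : IsRelComplemented a b) : b ≤ a := by
  choose z h₁ h₂ using h
  -- The complement of `x` pushed into `[a ⊓ b, b]`: `g ⊥ = b` and `g ⊤ = a ⊓ b`.
  let g : L → L := fun x => z x ⊓ b ⊔ a ⊓ b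
  have key (θ : LatticeCon L) (x y : L) (hxy : θ.r x y) : θ.r (g x) (g x ⊓ g y) := by
    have hx : g x ⊓ (a ⊔ y ⊔ g y) = g x :=
      le_of_forall_boundedLatticeHom_prop (fun p => by
        have := p.prop_mono (h₂ y)
        simp only [g, BoundedLatticeHom.prop_inf, BoundedLatticeHom.prop_sup] at this ⊢
        tauto) |> fun h => le_antisymm inf_le_left h
    have hy : g x ⊓ (a ⊔ x ⊔ g y) = g x ⊓ g y := by
      refine le_antisymm (le_of_forall_boundedLatticeHom_prop fun p => ?_) (by gcongr; simp)
      have := p.prop_mono (h₁ x)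
      simp only [g, BoundedLatticeHom.prop_inf, BoundedLatticeHom.prop_sup] at this ⊢
      tauto
    have := θ.inf (θ.refl (g x)) (θ.sup (θ.sup (θ.refl a) (θ.symm hxy)) (θ.refl (g y)))
    rwa [hx, hy] at this
  have hc : IsCompatible (k := 1) fun x => g (x 0) := by
    intro θ x y hxy
    refine θ.trans (key θ _ _ (hxy 0)) ?_
    rw [inf_comm]
    exact θ.symm (key θ _ _ (θ.symm (hxy 0)))
  have hm : g ⊥ ≤ g ⊤ := (hL 1 _ hc).monotone (bot_le : (fun _ => ⊥) ≤ fun _ => ⊤)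
  refine le_of_forall_boundedLatticeHom_prop fun p hb => ?_
  have e₁ := p.prop_mono (h₁ ⊤)
  have e₂ := p.prop_mono (h₂ ⊥)
  have e₃ := p.prop_mono hm
  have e₄ := p.prop_top
  have e₅ := p.not_prop_bot
  simp only [g, BoundedLatticeHom.prop_inf, BoundedLatticeHom.prop_sup] at e₁ e₂ e₃
  tauto

theorem IsPolynomialFun.finset_inf {ι : Type*} {k : ℕ} (s : Finset ι)
    {f : ι → (Fin k → L) → L} (hf : ∀ i ∈ s, IsPolynomialFun (f i)) :
    IsPolynomialFun fun x => s.inf fun i => f i x := by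
  classical
  induction s using Finset.induction_on with
  | empty => exact .const ⊤
  | insert i s _ ih =>
    simp only [Finset.inf_insert]
    exact .inf (hf i (by simp)) (ih fun j hj => hf j (by simp [hj]))

theorem IsPolynomialFun.finset_sup {ι : Type*} {k : ℕ} (s : Finset ι)
    {f : ι → (Fin k → L) → L} (hf : ∀ i ∈ s, IsPolynomialFun (f i)) :
    IsPolynomialFun fun x => s.sup fun i => f i x := by
  classical
  induction s using Finset.induction_on with
  | empty => exact .const ⊥
  | insert i s _ ih =>
    simp only [Finset.sup_insert]
    exact .sup (hf i (by simp)) (ih fun j hj => hf j (by simp [hj]))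

/-- The characteristic vector of a finite set of coordinates. -/
def charVec (L : Type*) [DistribLattice L] [BoundedOrder L] {k : ℕ} (S : Finset (Fin k)) :
    Fin k → L := fun i => if i ∈ S then ⊤ else ⊥

theorem BoundedLatticeHom.prop_charVec {k : ℕ} (p : BoundedLatticeHom L Prop)
    (S : Finset (Fin k)) (i : Fin k) : p (charVec L S i) ↔ i ∈ S := by
  by_cases h : i ∈ S
  · simp [charVec, h]
  · simp [charVec, h]

/-- When one coordinate varies from `⊥` to `⊤` through `x`, the value of `f` agrees with its old
value at primes omitting `x` and with its new value at primes containing `x`. It is therefore the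
relative complement required by `hL`. -/
theorem IsCompatible.charVec_mono (hL : ∀ a b : L, IsRelComplemented a b → b ≤ a) {k : ℕ}
    {f : (Fin k → L) → L} (hf : IsCompatible f) :
    Monotone fun S => f (charVec L S) := by
  refine Finset.monotone_iff_forall_le_cons.2 fun S i hi => ?_
  refine hL _ _ fun x => ⟨f (Function.update (charVec L S) i x), ?_⟩
  have hbot (p : BoundedLatticeHom L Prop) (hx : ¬ p x) :
      p (f (Function.update (charVec L S) i x)) ↔ p (f (charVec L S)) := by
    refine hf.prop_iff p fun j => ?_
    obtain rfl | hj := eq_or_ne j i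
    · simpa [hx, p.prop_charVec] using hi
    · simp [hj]
  have htop (p : BoundedLatticeHom L Prop) (hx : p x) :
      p (f (Function.update (charVec L S) i x)) ↔ p (f (charVec L (Finset.cons i S hi))) := by
    refine hf.prop_iff p fun j => ?_
    obtain rfl | hj := eq_or_ne j i
    · simpa [p.prop_charVec] using hx
    · simp [hj, p.prop_charVec]
  constructor <;> refine le_of_forall_boundedLatticeHom_prop fun p => ?_ <;>
  · have h₁ := hbot p
    have h₂ := htop p
    simp only [BoundedLatticeHom.prop_inf, BoundedLatticeHom.prop_sup]
    tauto

theorem BoundedLatticeHom.prop_finset_inf {ι : Type*} (p : BoundedLatticeHom L Prop)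
    (s : Finset ι) (f : ι → L) : p (s.inf f) ↔ ∀ i ∈ s, p (f i) := by
  classical
  induction s using Finset.induction_on with
  | empty => simp
  | insert i s _ ih => simp [p.prop_inf, ih]

theorem BoundedLatticeHom.prop_finset_sup {ι : Type*} (p : BoundedLatticeHom L Prop)
    (s : Finset ι) (f : ι → L) : p (s.sup f) ↔ ∃ i ∈ s, p (f i) := by
  classical
  induction s using Finset.induction_on with
  | empty => simp
  | insert i s _ ih => simp [p.prop_sup, ih]

theorem IsAffineComplete.of_le_of_isRelComplemented
    (hL : ∀ a b : L, IsRelComplemented a b → b ≤ a) : IsAffineComplete L := by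
  classical
  intro k f hf
  -- Disjunctive normal form: at each prime, `f` is determined by its values on characteristic
  -- vectors.
  have hpoly : IsPolynomialFun fun x => (Finset.univ : Finset (Finset (Fin k))).sup
      fun S => f (charVec L S) ⊓ S.inf fun i => x i :=
    .finset_sup _ fun S _ => .inf (.const _) (.finset_inf _ fun i _ => .proj i)
  convert hpoly using 1
  funext x
  have hx (p : BoundedLatticeHom L Prop) :
      p (f x) ↔ p (f (charVec L {i | p (x i)})) :=
    hf.prop_iff p fun i => by simp [p.prop_charVec]
  refine le_antisymm ?_ ?_ <;> refine le_of_forall_boundedLatticeHom_prop fun p => ?_ <;>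
    rw [p.prop_finset_sup, hx p]
  · intro h
    exact ⟨_, Finset.mem_univ _, (p.prop_inf _ _).2 ⟨h, (p.prop_finset_inf _ _).2 (by simp)⟩⟩
  · rintro ⟨S, -, h⟩
    obtain ⟨h₁, h₂⟩ := (p.prop_inf _ _).1 h
    rw [p.prop_finset_inf] at h₂
    exact p.prop_mono (hf.charVec_mono hL fun i hi => by simpa using h₂ i hi) h₁

/-- A bounded distributive lattice is affine complete if and only if it has no proper Boolean
interval. -/
theorem isAffineComplete_iff :
    IsAffineComplete L ↔ ∀ a b : L, IsRelComplemented a b → b ≤ a :=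
  ⟨fun hL _ _ => hL.le_of_isRelComplemented, .of_le_of_isRelComplemented⟩

end AffineComplete

/-! ### Generated bounded sublattices -/

section Generated

variable {I : Type*} {L : I → Type*} {M : Type*} [DistribLattice M] [BoundedOrder M]

/-- Membership in the bounded sublattice generated by the ranges of a family of maps. -/
inductive IsGenerated (ι : ∀ i, L i → M) : M → Prop
  | of (i : I) (a : L i) : IsGenerated ι (ι i a)
  | top : IsGenerated ι ⊤
  | bot : IsGenerated ι ⊥
  | inf {x y : M} : IsGenerated ι x → IsGenerated ι y → IsGenerated ι (x ⊓ y)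
  | sup {x y : M} : IsGenerated ι x → IsGenerated ι y → IsGenerated ι (x ⊔ y)

/-- The bounded sublattice generated by the ranges of a family of maps. -/
def generatedSublattice (ι : ∀ i, L i → M) : Sublattice M where
  carrier := {x | IsGenerated ι x}
  supClosed' _ hx _ hy := hx.sup hy
  infClosed' _ hx _ hy := hx.inf hy

instance (ι : ∀ i, L i → M) : BoundedOrder (generatedSublattice ι) :=
  Subtype.boundedOrder IsGenerated.bot IsGenerated.top

/-- The inclusion of the generated bounded sublattice. -/
def generatedSublatticeSubtype (ι : ∀ i, L i → M) :
    BoundedLatticeHom (generatedSublattice ι) M where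
  toFun := Subtype.val
  map_sup' _ _ := rfl
  map_inf' _ _ := rfl
  map_top' := rfl
  map_bot' := rfl

/-- A family of homomorphisms, corestricted to the bounded sublattice its ranges generate. -/
def toGeneratedSublattice [∀ i, DistribLattice (L i)] [∀ i, BoundedOrder (L i)]
    (ι : ∀ i, BoundedLatticeHom (L i) M) (i : I) :
    BoundedLatticeHom (L i) (generatedSublattice fun i => ι i) where
  toFun a := ⟨ι i a, .of i a⟩
  map_sup' _ _ := Subtype.ext (map_sup (ι i) _ _)
  map_inf' _ _ := Subtype.ext (map_inf (ι i) _ _)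
  map_top' := Subtype.ext (map_top (ι i))
  map_bot' := Subtype.ext (map_bot (ι i))

theorem isGenerated_toGeneratedSublattice [∀ i, DistribLattice (L i)] [∀ i, BoundedOrder (L i)]
    (ι : ∀ i, BoundedLatticeHom (L i) M) (x : generatedSublattice fun i => ι i) :
    IsGenerated (fun i => toGeneratedSublattice ι i) x := by
  obtain ⟨x, hx⟩ := x
  change IsGenerated _ x at hx
  induction hx with
  | of i a => exact .of (ι := fun i => toGeneratedSublattice ι i) i a
  | top => exact .top
  | bot => exact .bot
  | inf hx hy ihx ihy => exact .inf ihx ihy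
  | sup hx hy ihx ihy => exact .sup ihx ihy

theorem IsGenerated.hom_eq {ι : ∀ i, L i → M} {N : Type*} [DistribLattice N] [BoundedOrder N]
    {f g : BoundedLatticeHom M N} (h : ∀ i a, f (ι i a) = g (ι i a)) {x : M}
    (hx : IsGenerated ι x) : f x = g x := by
  induction hx with
  | of i a => exact h i a
  | top => simp
  | bot => simp
  | inf _ _ hx hy => simp [hx, hy]
  | sup _ _ hx hy => simp [hx, hy]

end Generated

/-! ### Existence of free products -/

section FreeProduct

variable {I : Type v} (L : I → BddDistLat.{max u v})

/-- The evaluation of an element at the points of the product of the prime spectra. -/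
def spectrumEval (i : I) :
    BoundedLatticeHom (L i) (Set (∀ i, BoundedLatticeHom (L i) Prop)) where
  toFun a := {x | x i a}
  map_sup' a b := Set.ext fun x => (x i).prop_sup a b
  map_inf' a b := Set.ext fun x => (x i).prop_inf a b
  map_top' := Set.ext fun x => iff_of_true (x i).prop_top trivial
  map_bot' := Set.ext fun x => iff_of_false (x i).not_prop_bot id

/-- The free product of a family of bounded distributive lattices, as a lattice of subsets of the
product of the prime spectra. -/
def freeProduct : BddDistLat.{max u v} :=
  .of (generatedSublattice fun i => spectrumEval L i)

/-- The canonical cofan on the free product. -/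
def freeProductCofan : Cofan L :=
  Cofan.mk (freeProduct L) fun i => BddDistLat.ofHom (toGeneratedSublattice (spectrumEval L) i)

variable {L} {M : BddDistLat.{max u v}} (g : ∀ i, BoundedLatticeHom (L i) M)

/-- A prime of `M` pulls back along `g` to a point of the product of spectra. Since primes separate,
`m` is determined by `s`, which makes the choice a homomorphism. -/
theorem exists_freeProduct_lift (s : freeProduct L) :
    ∃ m : M, ∀ q : BoundedLatticeHom M Prop, q m ↔ (fun i => q.comp (g i)) ∈ s.1 := by
  obtain ⟨s, hs⟩ := s
  change IsGenerated _ s at hs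
  change ∃ m : M, ∀ q : BoundedLatticeHom M Prop, q m ↔ (fun i => q.comp (g i)) ∈ s
  induction hs with
  | of i a => exact ⟨g i a, fun q => Iff.rfl⟩
  | top => exact ⟨⊤, fun q => iff_of_true q.prop_top trivial⟩
  | bot => exact ⟨⊥, fun q => iff_of_false q.not_prop_bot id⟩
  | inf _ _ hx hy =>
    obtain ⟨m, hm⟩ := hx
    obtain ⟨n, hn⟩ := hy
    exact ⟨m ⊓ n, fun q => (q.prop_inf m n).trans (and_congr (hm q) (hn q))⟩
  | sup _ _ hx hy =>
    obtain ⟨m, hm⟩ := hx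
    obtain ⟨n, hn⟩ := hy
    exact ⟨m ⊔ n, fun q => (q.prop_sup m n).trans (or_congr (hm q) (hn q))⟩

theorem eq_of_forall_boundedLatticeHom_prop {N : Type*} [DistribLattice N] [BoundedOrder N]
    {a b : N} (h : ∀ p : BoundedLatticeHom N Prop, p a ↔ p b) : a = b :=
  le_antisymm (le_of_forall_boundedLatticeHom_prop fun p => (h p).1)
    (le_of_forall_boundedLatticeHom_prop fun p => (h p).2)

/-- The homomorphism from the free product induced by a family of homomorphisms. -/
noncomputable def freeProductLift : BoundedLatticeHom (freeProduct L) M :=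
  have spec (s : freeProduct L) (q : BoundedLatticeHom M Prop) :=
    (exists_freeProduct_lift g s).choose_spec q
  { toFun := fun s => (exists_freeProduct_lift g s).choose
    map_sup' := fun s t => eq_of_forall_boundedLatticeHom_prop fun q => by
      rw [spec, q.prop_sup, spec, spec]; rfl
    map_inf' := fun s t => eq_of_forall_boundedLatticeHom_prop fun q => by
      rw [spec, q.prop_inf, spec, spec]; rfl
    map_top' := eq_of_forall_boundedLatticeHom_prop fun q => by
      rw [spec]; exact iff_of_true trivial q.prop_top
    map_bot' := eq_of_forall_boundedLatticeHom_prop fun q => by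
      rw [spec]; exact iff_of_false id q.not_prop_bot }

theorem freeProductLift_apply (i : I) (a : L i) :
    freeProductLift g (toGeneratedSublattice (spectrumEval L) i a) = g i a :=
  eq_of_forall_boundedLatticeHom_prop fun q =>
    (exists_freeProduct_lift g (toGeneratedSublattice (spectrumEval L) i a)).choose_spec q

variable (L) in
/-- The free product is a coproduct of bounded distributive lattices. -/
noncomputable def isColimitFreeProductCofan : IsColimit (freeProductCofan L) :=
  Cofan.IsColimit.mk _
    (fun c => BddDistLat.ofHom (freeProductLift fun i => (c.inj i).hom))
    (fun c i => BddDistLat.ext fun a => freeProductLift_apply (fun i => (c.inj i).hom) i a)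
    (fun c m hm => BddDistLat.ext fun x =>
      (isGenerated_toGeneratedSublattice (spectrumEval L) x).hom_eq (f := m.hom)
        (g := freeProductLift fun i => (c.inj i).hom) fun i a =>
          (congrArg (fun t : L i ⟶ c.pt => t.hom a) (hm i)).trans
            (freeProductLift_apply (fun i => (c.inj i).hom) i a).symm)

end FreeProduct

/-! ### Affine completeness of free products -/

section Coproduct

variable {I : Type v} {L : I → BddDistLat.{max u v}} {c : Cofan L}

/-- A coproduct of bounded distributive lattices is generated by its summands. -/
theorem isGenerated_of_isColimit (hc : IsColimit c) (x : c.pt) :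
    IsGenerated (fun i => (c.inj i).hom) x := by
  let r : c.pt ⟶ BddDistLat.of (generatedSublattice fun i => ((c.inj i).hom : L i → c.pt)) :=
    Cofan.IsColimit.desc hc fun i => BddDistLat.ofHom (toGeneratedSublattice (fun i => (c.inj i).hom) i)
  let s : BddDistLat.of (generatedSublattice fun i => ((c.inj i).hom : L i → c.pt)) ⟶ c.pt :=
    BddDistLat.ofHom (generatedSublatticeSubtype _)
  -- The corestriction followed by the inclusion fixes every summand, so it is the identity.
  have hrs : r ≫ s = 𝟙 c.pt := by
    refine Cofan.IsColimit.hom_ext hc _ _ fun i => ?_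
    rw [Category.comp_id, ← Category.assoc, Cofan.IsColimit.fac]
    rfl
  have hx : (r.hom x).1 = x := congrArg (fun t : c.pt ⟶ c.pt => t.hom x) hrs
  exact hx ▸ (r.hom x).2

open Classical in
/-- The homomorphism from the two-element lattice. -/
noncomputable def propHom (M : Type*) [DistribLattice M] [BoundedOrder M] :
    BoundedLatticeHom Prop M where
  toFun p := if p then ⊤ else ⊥
  map_sup' p q := by by_cases hp : p <;> by_cases hq : q <;> simp [hp, hq]
  map_inf' p q := by by_cases hp : p <;> by_cases hq : q <;> simp [hp, hq]
  map_top' := if_pos trivial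
  map_bot' := if_neg id

theorem propHom_of_true {M : Type*} [DistribLattice M] [BoundedOrder M] {p : Prop} (hp : p) :
    propHom M p = ⊤ := if_pos hp

theorem propHom_of_false {M : Type*} [DistribLattice M] [BoundedOrder M] {p : Prop}
    (hp : ¬ p) : propHom M p = ⊥ := if_neg hp

/-- For a prime filter `p` of a coproduct, there is a retraction onto each summand which acts on
the other summands as `p`. -/
theorem exists_retraction (hc : IsColimit c) (p : BoundedLatticeHom c.pt Prop) (i : I) :
    ∃ φ : BoundedLatticeHom c.pt (L i), (∀ a, φ ((c.inj i).hom a) = a) ∧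
      ∀ j, j ≠ i → ∀ a, φ ((c.inj j).hom a) = propHom (L i) (p ((c.inj j).hom a)) := by
  classical
  let d (j : I) : L j ⟶ L i :=
    if h : j = i then eqToHom (congrArg L h)
    else BddDistLat.ofHom ((propHom (L i)).comp (p.comp (c.inj j).hom))
  have hd (j : I) (a : L j) : (Cofan.IsColimit.desc hc d).hom ((c.inj j).hom a) = (d j).hom a :=
    congrArg (fun t : L j ⟶ L i => t.hom a) (Cofan.IsColimit.fac hc d j)
  refine ⟨(Cofan.IsColimit.desc hc d).hom, fun a => ?_, fun j hj a => ?_⟩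
  · rw [hd]
    simp [d]
  · rw [hd]
    simp only [d, dif_neg hj]
    rfl

variable {i : I} {p : BoundedLatticeHom c.pt Prop} {φ : BoundedLatticeHom c.pt (L i)}

/-- Isolates the part of `b` living in `L i`: the remaining factor `r` disappears under `φ`. -/
theorem IsGenerated.exists_inf_le
    (hφ : ∀ j, j ≠ i → ∀ a, φ ((c.inj j).hom a) = propHom (L i) (p ((c.inj j).hom a)))
    {b : c.pt} (hb : IsGenerated (fun i => (c.inj i).hom) b) (hpb : p b) :
    ∃ s r, (c.inj i).hom s ⊓ r ≤ b ∧ p ((c.inj i).hom s) ∧ φ r = ⊤ := by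
  induction hb with
  | of j a =>
    obtain rfl | hj := eq_or_ne j i
    · exact ⟨a, ⊤, inf_le_left, hpb, map_top φ⟩
    · exact ⟨⊤, _, inf_le_right, by simp,
        (hφ j hj a).trans (propHom_of_true hpb)⟩
  | top => exact ⟨⊤, ⊤, le_top, by simp, map_top φ⟩
  | bot => exact (p.not_prop_bot hpb).elim
  | inf _ _ hx hy =>
    obtain ⟨hpx, hpy⟩ := (p.prop_inf _ _).1 hpb
    obtain ⟨s, r, h, hs, hr⟩ := hx hpx
    obtain ⟨s', r', h', hs', hr'⟩ := hy hpy
    refine ⟨s ⊓ s', r ⊓ r', ?_, ?_, by simp [hr, hr']⟩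
    · rw [map_inf, inf_inf_inf_comm]
      exact inf_le_inf h h'
    · rw [map_inf]
      exact (p.prop_inf _ _).2 ⟨hs, hs'⟩
  | sup _ _ hx hy =>
    obtain hp | hp := (p.prop_sup _ _).1 hpb
    · obtain ⟨s, r, h, hs⟩ := hx hp
      exact ⟨s, r, h.trans le_sup_left, hs⟩
    · obtain ⟨s, r, h, hs⟩ := hy hp
      exact ⟨s, r, h.trans le_sup_right, hs⟩

theorem IsGenerated.exists_le_sup
    (hφ : ∀ j, j ≠ i → ∀ a, φ ((c.inj j).hom a) = propHom (L i) (p ((c.inj j).hom a)))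
    {b : c.pt} (hb : IsGenerated (fun i => (c.inj i).hom) b) (hpb : ¬ p b) :
    ∃ s r, b ≤ (c.inj i).hom s ⊔ r ∧ ¬ p ((c.inj i).hom s) ∧ φ r = ⊥ := by
  induction hb with
  | of j a =>
    obtain rfl | hj := eq_or_ne j i
    · exact ⟨a, ⊥, le_sup_left, hpb, map_bot φ⟩
    · exact ⟨⊥, _, le_sup_right, by simp,
        (hφ j hj a).trans (propHom_of_false hpb)⟩
  | top => exact (hpb p.prop_top).elim
  | bot => exact ⟨⊥, ⊥, bot_le, by simp, map_bot φ⟩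
  | inf x y hx hy =>
    obtain hp | hp := not_and_or.1 (mt (p.prop_inf _ _).2 hpb)
    · obtain ⟨s, r, h, hs⟩ := hx hp
      exact ⟨s, r, inf_le_left.trans h, hs⟩
    · obtain ⟨s, r, h, hs⟩ := hy hp
      exact ⟨s, r, inf_le_right.trans h, hs⟩
  | sup x y hx hy =>
    obtain ⟨hpx, hpy⟩ := not_or.1 (mt (p.prop_sup _ _).2 hpb)
    obtain ⟨s, r, h, hs, hr⟩ := hx hpx
    obtain ⟨s', r', h', hs', hr'⟩ := hy hpy
    refine ⟨s ⊔ s', r ⊔ r', ?_, ?_, by simp [hr, hr']⟩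
    · rw [map_sup, sup_sup_sup_comm]
      exact sup_le_sup h h'
    · rw [map_sup]
      exact fun hp => ((p.prop_sup _ _).1 hp).elim hs hs'

/-- A coproduct is affine complete as soon as one of its summands is. -/
theorem isAffineComplete_of_isColimit (hc : IsColimit c) (i : I)
    (hL : IsAffineComplete (L i)) : IsAffineComplete c.pt := by
  rw [isAffineComplete_iff] at hL ⊢
  intro a b hab
  by_contra hba
  obtain ⟨p, hpb, hpa⟩ := exists_boundedLatticeHom_prop_of_not_le hba
  obtain ⟨φ, hφ, hφ'⟩ := exists_retraction hc p i
  obtain ⟨s, r, hb, hs, hr⟩ := (isGenerated_of_isColimit hc b).exists_inf_le hφ' hpb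
  obtain ⟨t, q, ha, ht, hq⟩ := (isGenerated_of_isColimit hc a).exists_le_sup hφ' hpa
  -- `φ` maps `s ⊓ r` to `s` and `t ⊔ q` to `t`, and carries complements to complements.
  have hts : IsRelComplemented t s := by
    intro x
    obtain ⟨z, h₁, h₂⟩ := hab.mono ha hb ((c.inj i).hom x)
    refine ⟨φ z, ?_, ?_⟩
    · simpa [hφ, hr, hq] using OrderHomClass.mono φ h₁
    · simpa [hφ, hr, hq] using OrderHomClass.mono φ h₂
  exact ht (p.prop_mono (OrderHomClass.mono (c.inj i).hom (hL t s hts)) hs)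

end Coproduct

theorem mainTheorem4 {I : Type v} [Nonempty I] (L : I → BddDistLat.{max u v})
    (hL : ∀ i, IsAffineComplete (L i)) :
    HasCoproduct L ∧
      ∀ c : Cofan L, Nonempty (IsColimit c) → IsAffineComplete c.pt :=
  ⟨⟨⟨⟨_, isColimitFreeProductCofan L⟩⟩⟩, fun _ ⟨hc⟩ =>
    isAffineComplete_of_isColimit hc (Classical.arbitrary I) (hL _)⟩
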